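/- All graphs are finite, simple and undirected. An antimagic labeling of a graph $G$ is a bijection $f:E(G)\to\{1,\dots,|E(G)|\}$ such that the vertex sums $w(u)=\sum_{e\ni u}f(e)$, $u\in V(G)$, are pairwise distinct; $G$ is antimagic if it has such a labeling. For a graph $G$ with edges $e_1,\dots,e_m$ and graphs $H_1,\dots,H_m$, the generalized edge corona $G\diamond(H_1,\dots,H_m)$ is obtained from disjoint copies of $G,H_1,\dots,H_m$ by joining, for each $i$, both end vertices of $e_i$ to every vertex of $H_i$. Let $p>2$ and let $G_2$ be the spider with centre $v_0$ and three legs $v_0x_1x_2\cdots x_p$, $v_0y_1y_2\cdots y_p$, $v_0z_1z_2\cdots z_p$, with its $3p$ edges enumerated from the tips to the centre as $$x_px_{p-1},\ y_py_{p-1},\ z_pz_{p-1},\ x_{p-1}x_{p-2},\ y_{p-1}y_{p-2},\ z_{p-1}z_{p-2},\ \dots,\ x_2x_1,\ y_2y_1,\ z_2z_1,\ x_1v_0,\ y_1v_0,\ z_1v_0 .$$ Let $H_1,\dots,H_{3p}$ be connected graphs, each with at least two vertices, such that $|V(H_i)|\le|V(H_{i+1})|$ for $1\le i\le 3p-1$.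 Write $\Delta(H_i),\delta(H_i)$ for the maximum and minimum degree of $H_i$, $d'(v)$ for the degree of a vertex $v$ in $G_2\diamond(H_1,\dots,H_{3p})$, and $\Delta'(H_i),\delta'(H_i)$ for the maximum and minimum of $d'(v)$ over $v\in V(H_i)$. Suppose that (i) $\Delta(H_i)\le\delta(H_{i+1})$ for all $1\le i\le 3p-1$; (ii) $d'(x_p)\le\delta'(H_2)$, $d'(y_p)\le\delta'(H_3)$ and $d'(z_p)\le\delta'(H_4)$; (iii) $\Delta'(H_i)\le|V(H_4)|+1$ for the $H_i$ whose vertices are joined to $z_1$ and $z_2$ (that is, $i=3p-3$); (iv) $d'(z_2)\le\delta'(H_i)$ for the $H_i$ whose vertices are joined to $x_1$ and $v_0$ (that is, $i=3p-2$). Then $G_2\diamond(H_1,\dots,H_{3p})$ is antimagic. -/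

import Mathlib

/-- `G` is antimagic: there is a labeling `f` of the edges, bijective from `E(G)` onto
`{1, …, |E(G)|}`, such that distinct vertices have distinct sums of incident edge labels.
(Only the values of `f` on edges of `G` matter.) -/
def IsAntimagic {V : Type*} [Fintype V] (G : SimpleGraph V) : Prop := by
  classical
  exact ∃ f : Sym2 V → ℕ,
    Set.BijOn f G.edgeSet (Set.Icc 1 G.edgeFinset.card) ∧
    Function.Injective (fun v : V => ∑ e ∈ G.incidenceFinset v, f e)

/-- The generalized edge corona of a graph `G`, whose edges are enumerated by `e`, and a family
of graphs `H i`: take disjoint copies of `G` and of all the `H i`, and join both end vertices of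
the `i`-th edge of `G` to every vertex of `H i`. -/
def generalizedEdgeCorona {V ι : Type*} {W : ι → Type*} (G : SimpleGraph V)
    (e : ι ≃ G.edgeSet) (H : ∀ i, SimpleGraph (W i)) : SimpleGraph (V ⊕ (Σ i, W i)) where
  Adj
    | .inl a, .inl b => G.Adj a b
    | .inl a, .inr w => a ∈ (e w.1 : Sym2 V)
    | .inr w, .inl a => a ∈ (e w.1 : Sym2 V)
    | .inr w, .inr w' => ∃ (i : ι) (u u' : W i), w = ⟨i, u⟩ ∧ w' = ⟨i, u'⟩ ∧ (H i).Adj u u'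
  symm := ⟨by
    rintro (a | w) (b | w') h
    · exact G.adj_symm h
    · exact h
    · exact h
    · obtain ⟨i, u, u', rfl, rfl, h⟩ := h
      exact ⟨i, u', u, rfl, rfl, h.symm⟩⟩
  loopless := ⟨by
    rintro (a | w) h
    · exact G.irrefl h
    · obtain ⟨i, u, u', rfl, h, hadj⟩ := h
      cases h
      exact (H i).irrefl hadj⟩

/-- Vertices of the spider with three legs of `p` vertices each: `none` is the centre `v₀`, and
`some (l, k)` is the vertex at distance `k + 1` from `v₀` on leg `l`. -/
abbrev SpiderVertex (p : ℕ) : Type := Option (Fin 3 × Fin p)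

/-- The vertex at distance `k` from the centre on leg `l`; the legs `l = 0, 1, 2` are
`x₁, …, x_p`, `y₁, …, y_p` and `z₁, …, z_p`, and distance `0` gives the centre `v₀`. -/
def legVertex {p : ℕ} (l : Fin 3) (k : Fin (p + 1)) : SpiderVertex p :=
  Fin.cases none (fun j => some (l, j)) k

/-- The spider with three legs, each a path on `p` vertices: on each leg, the vertices at
distance `k` and `k + 1` from the centre are adjacent. -/
def spiderGraph (p : ℕ) : SimpleGraph (SpiderVertex p) :=
  SimpleGraph.fromRel fun a b =>
    ∃ (l : Fin 3) (k : Fin p), a = legVertex l k.castSucc ∧ b = legVertex l k.succ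

/-- The leg `i mod 3` on which the edge with (0-based) number `i` lies. -/
def spiderEdgeLeg {p : ℕ} (i : Fin (3 * p)) : Fin 3 := ⟨i % 3, Nat.mod_lt _ (by norm_num)⟩

/-- The distance from the centre to the nearer end of the edge with (0-based) number `i`. -/
def spiderEdgePos {p : ℕ} (i : Fin (3 * p)) : Fin p := ⟨p - 1 - i / 3, by have := i.2; omega⟩

/-- The edges of the spider, listed from the tips of the legs towards the centre:
`x_p x_{p-1}, y_p y_{p-1}, z_p z_{p-1}, x_{p-1} x_{p-2}, …, x₁ v₀, y₁ v₀, z₁ v₀`. -/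
def spiderEdge {p : ℕ} (i : Fin (3 * p)) : Sym2 (SpiderVertex p) :=
  s(legVertex (spiderEdgeLeg i) (spiderEdgePos i).succ,
    legVertex (spiderEdgeLeg i) (spiderEdgePos i).castSucc)

theorem legVertex_succ {p : ℕ} (l : Fin 3) (k : Fin p) :
    legVertex l k.succ = some (l, k) := rfl

theorem legVertex_eq_some {p : ℕ} {l l' : Fin 3} {k : Fin (p + 1)} {j : Fin p}
    (h : legVertex l k = some (l', j)) : l = l' ∧ k = j.succ := by
  induction k using Fin.cases with
  | zero => simp [legVertex] at h
  | succ k => simpa [legVertex] using h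

theorem spiderEdge_mem {p : ℕ} (i : Fin (3 * p)) : spiderEdge i ∈ (spiderGraph p).edgeSet := by
  rw [spiderEdge, SimpleGraph.mem_edgeSet, spiderGraph, SimpleGraph.fromRel_adj]
  refine ⟨fun h => ?_, Or.inr ⟨_, _, rfl, rfl⟩⟩
  rw [legVertex_succ] at h
  have := congrArg Fin.val (legVertex_eq_some h.symm).2
  simp at this

theorem spiderEdge_injective {p : ℕ} : Function.Injective (spiderEdge (p := p)) := by
  intro i j h
  have key : spiderEdgeLeg i = spiderEdgeLeg j ∧ spiderEdgePos i = spiderEdgePos j := by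
    rw [spiderEdge, spiderEdge, Sym2.eq_iff, legVertex_succ, legVertex_succ] at h
    rcases h with ⟨h, -⟩ | ⟨h, h'⟩
    · simpa using h
    · have h1 := congrArg Fin.val (legVertex_eq_some h.symm).2
      have h2 := congrArg Fin.val (legVertex_eq_some h').2
      simp only [Fin.val_castSucc, Fin.val_succ] at h1 h2
      omega
  have h1 := congrArg Fin.val key.1
  have h2 := congrArg Fin.val key.2
  simp only [spiderEdgeLeg, spiderEdgePos] at h1 h2
  have := i.2
  have := j.2
  ext
  omega

theorem exists_spiderEdge {p : ℕ} (l : Fin 3) (k : Fin p) :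
    ∃ i : Fin (3 * p), spiderEdgeLeg i = l ∧ spiderEdgePos i = k := by
  have := l.2
  have := k.2
  refine ⟨⟨3 * (p - 1 - k) + l, by omega⟩, ?_, ?_⟩
  · ext; simp only [spiderEdgeLeg]; omega
  · ext; simp only [spiderEdgePos]; omega

theorem spiderEdge_bijective {p : ℕ} : Function.Bijective
    (fun i : Fin (3 * p) => (⟨spiderEdge i, spiderEdge_mem i⟩ : (spiderGraph p).edgeSet)) := by
  refine ⟨fun i j h => spiderEdge_injective (congrArg Subtype.val h), ?_⟩
  rintro ⟨e, he⟩
  induction e using Sym2.ind with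
  | _ a b =>
    rw [SimpleGraph.mem_edgeSet, spiderGraph, SimpleGraph.fromRel_adj] at he
    rcases he with ⟨-, ⟨l, k, rfl, rfl⟩ | ⟨l, k, rfl, rfl⟩⟩ <;>
    · obtain ⟨i, rfl, rfl⟩ := exists_spiderEdge l k
      refine ⟨i, Subtype.ext ?_⟩
      simp [spiderEdge, Sym2.eq_swap]

/-- The enumeration `spiderEdge` of the edges of the spider, as a bijection. -/
noncomputable def spiderEdgeEquiv (p : ℕ) : Fin (3 * p) ≃ (spiderGraph p).edgeSet :=
  Equiv.ofBijective _ spiderEdge_bijective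

/-- The graph `G₂ ⋄ (H₁, …, H_{3p})`, where `G₂` is the spider with three legs of `p` vertices
and `H_{i+1}` is `H i` for `i : Fin (3 * p)`. -/
noncomputable def spiderCorona {p : ℕ} {W : Fin (3 * p) → Type*}
    (H : ∀ i, SimpleGraph (W i)) : SimpleGraph (SpiderVertex p ⊕ (Σ i, W i)) :=
  generalizedEdgeCorona (spiderGraph p) (spiderEdgeEquiv p) H

/-- `d'(v)`: the degree of a vertex `v` in `G₂ ⋄ (H₁, …, H_{3p})`. -/
noncomputable def coronaDegree {p : ℕ} {W : Fin (3 * p) → Type*} [∀ i, Fintype (W i)]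
    (H : ∀ i, SimpleGraph (W i)) (v : SpiderVertex p ⊕ (Σ i, W i)) : ℕ := by
  classical
  exact (spiderCorona H).degree v

/-- `Δ'(H_i)`: the maximum of `d'(w)` over the vertices `w` of `H i`. -/
noncomputable def coronaMaxDegree {p : ℕ} {W : Fin (3 * p) → Type*} [∀ i, Fintype (W i)]
    (H : ∀ i, SimpleGraph (W i)) (i : Fin (3 * p)) : ℕ :=
  ⨆ w : W i, coronaDegree H (.inr ⟨i, w⟩)

/-- `δ'(H_i)`: the minimum of `d'(w)` over the vertices `w` of `H i`. -/
noncomputable def coronaMinDegree {p : ℕ} {W : Fin (3 * p) → Type*} [∀ i, Fintype (W i)]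
    (H : ∀ i, SimpleGraph (W i)) (i : Fin (3 * p)) : ℕ :=
  ⨅ w : W i, coronaDegree H (.inr ⟨i, w⟩)

/-! Call an edge from a vertex of `H i` to the spider inner or outer, according to the end of the
`i`-th spider edge that it reaches. The edges are labeled in blocks of increasing rank. The three
tip groups come one after another, each in the order: edges of `H i`, inner edges, outer edges,
spider edge. The intermediate groups follow together, kind by kind and by `i` within a kind. In the
three groups at the centre, edges of `H i` and outer edges precede inner edges and spider edges.

Two mechanisms separate the vertex sums. The first is domination: the summands at one vertex are
matched with summands at another that are no smaller, and strictness comes from one pair or from a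
leftover summand. The conditions on orders and degrees supply the counting
(`weight_outerVertex_lt_weight_inr`, `weight_inr_lt_weight_outerVertex` and their companions). The
centre dominates every other vertex.

The second is tie-breaking (`Finset.exists_labeling_of_rank`): if two vertices each have one edge in
a common highest block, that block is sorted by the sums of the earlier labels. A smaller partial
sum gets a smaller last label, and equal partial sums are separated by injectivity of the labeling.
This handles two vertices of one `H i` away from the centre, and all of `x₁`, `y₁`, `z₁` and the
vertices of the last three `H i`, whose highest edges share the final block. `weight_injective`
combines the two. -/

/-! ### Labeling by blocks, and comparison of finite sums. -/

open Finset in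
theorem Finset.exists_bijOn_Icc_strictMono_on_key {α : Type*} (T : Finset α) (key : α → ℕ)
    (n : ℕ) :
    ∃ g : α → ℕ, Set.BijOn g T (Set.Icc (n + 1) (n + #T)) ∧
      ∀ a ∈ T, ∀ b ∈ T, key a < key b → g a < g b := by
  classical
  induction T using Finset.induction_on_max_value key with
  | empty => exact ⟨fun _ => 0, by simp, by simp⟩
  | insert a s ha hmax ih =>
    obtain ⟨g, hg, hkey⟩ := ih
    have hne : ∀ x ∈ s, x ≠ a := fun x hx h => ha (h ▸ hx)
    have hle : ∀ x ∈ s, g x ≤ n + #s := fun x hx => (hg.mapsTo hx).2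
    refine ⟨Function.update g a (n + #s + 1), ?_, ?_⟩
    · have hIcc : Set.Icc (n + 1) (n + #(insert a s))
          = insert (n + #s + 1) (Set.Icc (n + 1) (n + #s)) := by
        rw [card_insert_of_notMem ha]
        ext x
        simp only [Set.mem_Icc, Set.mem_insert_iff]
        omega
      have h1 : Set.BijOn (Function.update g a (n + #s + 1)) s (Set.Icc (n + 1) (n + #s)) :=
        hg.congr fun x hx => by simp [Function.update_of_ne (hne x hx)]
      rw [hIcc, coe_insert]
      have := h1.insert (a := a) (by simp)
      simpa using this
    · intro x hx y hy hxy
      rw [mem_insert] at hx hy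
      rcases hx with rfl | hx <;> rcases hy with rfl | hy
      · omega
      · exact absurd (hmax y hy) (by omega)
      · rw [Function.update_of_ne (hne x hx), Function.update_self]
        exact Nat.lt_succ_of_le (hle x hx)
      · rw [Function.update_of_ne (hne x hx), Function.update_of_ne (hne y hy)]
        exact hkey x hx y hy hxy

open Finset in
/-- A finite set can be labeled by `1, …, #E` block by block, in order of increasing rank, where
the order within a block respects a key computed from the labels of the earlier blocks. -/
theorem Finset.exists_bijOn_Icc_of_rank {α : Type*} (E : Finset α) (A : α → Finset α)
    (r : α → ℕ) :
    ∃ g : α → ℕ, Set.BijOn g E (Set.Icc 1 #E) ∧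
      (∀ a ∈ E, ∀ b ∈ E, r a < r b → g a < g b) ∧
      (∀ a ∈ E, ∀ b ∈ E, r a = r b →
        ∑ x ∈ A a with r x < r a, g x < ∑ x ∈ A b with r x < r b, g x → g a < g b) := by
  classical
  -- Induction on the number of ranks already labeled: the key of rank `n` involves only labels of
  -- rank below `n`, which later steps leave unchanged.
  have main : ∀ n : ℕ, ∃ g : α → ℕ,
      Set.BijOn g (E.filter (r · < n)) (Set.Icc 1 #(E.filter (r · < n))) ∧
      (∀ a ∈ E, ∀ b ∈ E, r b < n → r a < r b → g a < g b) ∧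
      (∀ a ∈ E, ∀ b ∈ E, r b < n → r a = r b →
        ∑ x ∈ A a with r x < r a, g x < ∑ x ∈ A b with r x < r b, g x → g a < g b) := by
    intro n
    induction n with
    | zero => exact ⟨fun _ => 0, by simp, by simp, by simp⟩
    | succ n ih =>
      obtain ⟨g, hg, hr, hk⟩ := ih
      obtain ⟨g', hg', hk'⟩ := (E.filter (r · = n)).exists_bijOn_Icc_strictMono_on_key
        (fun a => ∑ x ∈ A a with r x < n, g x) #(E.filter (r · < n))
      let f : α → ℕ := fun x => if r x < n then g x else g' x
      have hf1 : ∀ x, r x < n → f x = g x := fun x hx => if_pos hx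
      have hf2 : ∀ x, r x = n → f x = g' x := fun x hx => if_neg (by omega)
      have hsum : ∀ (s : Finset α) (m : ℕ), m ≤ n →
          ∑ x ∈ s with r x < m, f x = ∑ x ∈ s with r x < m, g x := by
        intro s m hm
        refine sum_congr rfl fun x hx => hf1 x ?_
        have := (mem_filter.1 hx).2
        omega
      have b1 : Set.BijOn f (E.filter (r · < n)) (Set.Icc 1 #(E.filter (r · < n))) :=
        hg.congr fun x hx => (hf1 x (mem_filter.1 hx).2).symm
      have b2 := hg'.congr (f₂ := f) fun x hx => (hf2 x (mem_filter.1 hx).2).symm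
      have hE : E.filter (r · < n + 1) = E.filter (r · < n) ∪ E.filter (r · = n) := by
        ext x
        simp only [mem_filter, mem_union]
        grind
      have hdisj : Disjoint (E.filter (r · < n)) (E.filter (r · = n)) := by
        rw [disjoint_filter]
        intros
        omega
      refine ⟨f, ?_, ?_, ?_⟩
      · have hIcc : Set.Icc 1 #(E.filter (r · < n + 1)) = Set.Icc 1 #(E.filter (r · < n)) ∪
            Set.Icc (#(E.filter (r · < n)) + 1)
              (#(E.filter (r · < n)) + #(E.filter (r · = n))) := by
          rw [hE, card_union_of_disjoint hdisj]
          ext x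
          simp only [Set.mem_Icc, Set.mem_union]
          omega
        rw [hIcc, hE, coe_union]
        refine b1.union b2 ?_
        rw [← coe_union]
        intro x hx y hy hxy
        rcases mem_union.1 (mem_coe.1 hx) with hx | hx <;>
          rcases mem_union.1 (mem_coe.1 hy) with hy | hy
        · exact b1.injOn hx hy hxy
        · have h1 := (b1.mapsTo hx).2
          have h2 := (b2.mapsTo hy).1
          omega
        · have h1 := (b1.mapsTo hy).2
          have h2 := (b2.mapsTo hx).1
          omega
        · exact b2.injOn hx hy hxy
      · intro a ha b hb hbn hab
        rcases Nat.lt_succ_iff_lt_or_eq.1 hbn with h | h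
        · rw [hf1 a (by omega), hf1 b h]
          exact hr a ha b hb h hab
        · have h1 := (b1.mapsTo (mem_coe.2 (mem_filter.2 ⟨ha, show r a < n by omega⟩))).2
          have h2 := (b2.mapsTo (mem_coe.2 (mem_filter.2 ⟨hb, h⟩))).1
          omega
      · intro a ha b hb hbn hab hlt
        rw [hsum _ _ (by omega), hsum _ _ (by omega)] at hlt
        rcases Nat.lt_succ_iff_lt_or_eq.1 hbn with h | h
        · rw [hf1 a (by omega), hf1 b h]
          exact hk a ha b hb h hab hlt
        · rw [hf2 a (by omega), hf2 b h]
          rw [hab, h] at hlt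
          exact hk' a (mem_filter.2 ⟨ha, by omega⟩) b (mem_filter.2 ⟨hb, h⟩) hlt
  obtain ⟨g, hg, hr, hk⟩ := main (E.sup r + 1)
  have hlt : ∀ x ∈ E, r x < E.sup r + 1 := fun x hx => Nat.lt_succ_of_le (le_sup hx)
  rw [filter_true_of_mem hlt] at hg
  exact ⟨g, hg, fun a ha b hb => hr a ha b hb (hlt b hb),
    fun a ha b hb => hk a ha b hb (hlt b hb)⟩

open Finset in
/-- A labeling by blocks in which two vertices have different sums as soon as each has a single
incident edge of highest rank, anchored at it, and these ranks agree. -/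
theorem Finset.exists_labeling_of_rank {α V : Type*} (E : Finset α) (inc : V → Finset α)
    (hinc : ∀ v, inc v ⊆ E) (r : α → ℕ) (t : α → V) :
    ∃ g : α → ℕ, Set.BijOn g E (Set.Icc 1 #E) ∧
      (∀ a ∈ E, ∀ b ∈ E, r a < r b → g a < g b) ∧
      (∀ a ∈ inc (t a), ∀ b ∈ inc (t b), t a ≠ t b → r a = r b →
        (∀ x ∈ inc (t a), x ≠ a → r x < r a) → (∀ x ∈ inc (t b), x ≠ b → r x < r b) →
        ∑ x ∈ inc (t a), g x ≠ ∑ x ∈ inc (t b), g x) := by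
  classical
  obtain ⟨g, hg, hr, hk⟩ := E.exists_bijOn_Icc_of_rank (fun a => inc (t a)) r
  refine ⟨g, hg, hr, fun a ha b hb hab hrab hmaxa hmaxb => ?_⟩
  -- Since `c` is the only incident edge of highest rank, the remaining labels at its anchor form
  -- exactly the key by which the block was sorted.
  have key : ∀ c ∈ inc (t c), (∀ x ∈ inc (t c), x ≠ c → r x < r c) →
      ∑ x ∈ inc (t c), g x = g c + ∑ x ∈ inc (t c) with r x < r c, g x := by
    intro c hc hmax
    rw [← add_sum_erase _ _ hc]
    congr 1
    refine sum_congr ?_ fun _ _ => rfl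
    ext x
    simp only [mem_erase, mem_filter]
    constructor
    · exact fun h => ⟨h.2, hmax x h.2 h.1⟩
    · rintro ⟨h1, h2⟩
      exact ⟨fun h => by simp [h] at h2, h1⟩
  rw [key a ha hmaxa, key b hb hmaxb]
  have hne : g a ≠ g b := fun h =>
    hab (congrArg t (hg.injOn (hinc _ ha) (hinc _ hb) h))
  have h1 := hk a (hinc _ ha) b (hinc _ hb) hrab
  have h2 := hk b (hinc _ hb) a (hinc _ ha) hrab.symm
  omega

-- The maximum of `f` on `s` separates the two families of values, so both sums compare with
-- multiples of it.
open Finset in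
theorem Finset.sum_le_sum_of_card_le_of_forall_le {ι κ : Type*} {s : Finset ι} {t : Finset κ}
    {f : ι → ℕ} {g : κ → ℕ} (hcard : #s ≤ #t) (h : ∀ a ∈ s, ∀ b ∈ t, f a ≤ g b) :
    ∑ a ∈ s, f a ≤ ∑ b ∈ t, g b := by
  calc ∑ a ∈ s, f a ≤ #s • s.sup f := sum_le_card_nsmul _ _ _ fun a ha => le_sup ha
    _ ≤ #t • s.sup f := Nat.mul_le_mul_right _ hcard
    _ ≤ ∑ b ∈ t, g b := card_nsmul_le_sum _ _ _ fun b hb => Finset.sup_le fun a ha => h a ha b hb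

/-! ### Ends of the spider edges. -/

/-- The end of the `i`-th edge of the spider farther from the centre. -/
def outerVertex {p : ℕ} (i : Fin (3 * p)) : SpiderVertex p :=
  some (spiderEdgeLeg i, spiderEdgePos i)

/-- The end of the `i`-th edge of the spider nearer to the centre. -/
def innerVertex {p : ℕ} (i : Fin (3 * p)) : SpiderVertex p :=
  legVertex (spiderEdgeLeg i) (spiderEdgePos i).castSucc

theorem spiderEdge_eq {p : ℕ} (i : Fin (3 * p)) :
    spiderEdge i = s(outerVertex i, innerVertex i) := rfl

theorem outerVertex_injective {p : ℕ} : Function.Injective (outerVertex (p := p)) := by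
  intro i j h
  simp only [outerVertex, Option.some.injEq, Prod.mk.injEq, spiderEdgeLeg, spiderEdgePos,
    Fin.mk.injEq] at h
  have := i.2
  have := j.2
  ext
  omega

theorem outerVertex_ne_none {p : ℕ} (i : Fin (3 * p)) : outerVertex i ≠ none := by
  simp [outerVertex]

theorem exists_outerVertex {p : ℕ} {a : SpiderVertex p} (ha : a ≠ none) :
    ∃ i, outerVertex i = a := by
  obtain ⟨⟨l, k⟩, rfl⟩ := Option.ne_none_iff_exists'.1 ha
  obtain ⟨i, rfl, rfl⟩ := exists_spiderEdge l k
  exact ⟨i, rfl⟩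

theorem innerVertex_eq_none {p : ℕ} {i : Fin (3 * p)} (h : 3 * p ≤ i + 3) :
    innerVertex i = none := by
  have : (spiderEdgePos i).castSucc = ⟨0, by omega⟩ := by
    ext
    simp only [spiderEdgePos, Fin.castSucc_mk]
    omega
  rw [innerVertex, this]
  rfl

/-- The enumeration cycles through the three legs, so three steps later it reaches the next edge of
the same leg towards the centre. -/
theorem innerVertex_eq_outerVertex {p : ℕ} {i j : Fin (3 * p)} (h : (j : ℕ) = i + 3) :
    innerVertex i = outerVertex j := by
  have hj := j.2
  have h1 : (spiderEdgePos i).castSucc = (spiderEdgePos j).succ := by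
    ext
    simp only [spiderEdgePos, Fin.castSucc_mk, Fin.succ_mk]
    omega
  have h2 : spiderEdgeLeg i = spiderEdgeLeg j := by
    ext
    simp only [spiderEdgeLeg]
    omega
  rw [innerVertex, h1, h2]
  rfl

theorem innerVertex_eq_none_iff {p : ℕ} {i : Fin (3 * p)} :
    innerVertex i = none ↔ 3 * p ≤ i + 3 := by
  refine ⟨fun h => ?_, innerVertex_eq_none⟩
  by_contra hlt
  rw [innerVertex_eq_outerVertex (j := ⟨i + 3, by omega⟩) rfl] at h
  exact outerVertex_ne_none _ h

theorem innerVertex_eq_outerVertex_iff {p : ℕ} {i j : Fin (3 * p)} :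
    innerVertex i = outerVertex j ↔ (j : ℕ) = i + 3 := by
  refine ⟨fun h => ?_, innerVertex_eq_outerVertex⟩
  by_cases hi : 3 * p ≤ i + 3
  · rw [innerVertex_eq_none hi] at h
    exact absurd h.symm (outerVertex_ne_none j)
  · rw [innerVertex_eq_outerVertex (j := ⟨i + 3, by omega⟩) rfl] at h
    exact congrArg Fin.val (outerVertex_injective h).symm

theorem innerVertex_ne_outerVertex {p : ℕ} (i : Fin (3 * p)) : innerVertex i ≠ outerVertex i := by
  rw [Ne, innerVertex_eq_outerVertex_iff]
  omega

/-! ### Edges of the corona as a sum type. -/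

/-- Names for the edges of the corona: pairs inside some `W i`, the edges from a vertex of `W i`
to the inner and to the outer end of the `i`-th edge of the spider, and the spider edges. -/
abbrev CoronaEdge {p : ℕ} (W : Fin (3 * p) → Type*) :=
  (Σ i, Sym2 (W i)) ⊕ (Σ i, W i) ⊕ (Σ i, W i) ⊕ Fin (3 * p)

namespace CoronaEdge

/-- The pair of vertices of the corona named by a `CoronaEdge`. -/
def toSym2 {p : ℕ} {W : Fin (3 * p) → Type*} :
    CoronaEdge W → Sym2 (SpiderVertex p ⊕ (Σ i, W i))
  | .inl ⟨i, ε⟩ => ε.map fun w => .inr ⟨i, w⟩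
  | .inr (.inl w) => s(.inl (innerVertex w.1), .inr w)
  | .inr (.inr (.inl w)) => s(.inl (outerVertex w.1), .inr w)
  | .inr (.inr (.inr i)) => s(.inl (outerVertex i), .inl (innerVertex i))

theorem toSym2_injective {p : ℕ} {W : Fin (3 * p) → Type*} :
    Function.Injective (toSym2 (W := W)) := by
  have hspider : ∀ i j : Fin (3 * p), s(outerVertex i, innerVertex i) =
      s(outerVertex j, innerVertex j) → i = j := fun i j h => spiderEdge_injective h
  rintro (⟨i, ε⟩ | w | w | i) (⟨j, ε'⟩ | w' | w' | j) h
  · induction ε using Sym2.ind with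
    | _ a b =>
    induction ε' using Sym2.ind with
    | _ c d =>
      simp only [toSym2, Sym2.map_mk, Sym2.eq_iff, Sum.inr.injEq, Sigma.mk.injEq] at h
      rcases h with ⟨⟨rfl, h1⟩, -, h2⟩ | ⟨⟨rfl, h1⟩, -, h2⟩
      · rw [eq_of_heq h1, eq_of_heq h2]
      · rw [eq_of_heq h1, eq_of_heq h2, Sym2.eq_swap]
  all_goals first
    | (induction ε using Sym2.ind; simp [toSym2] at h)
    | (induction ε' using Sym2.ind; simp [toSym2] at h)
    | skip
  all_goals simp [toSym2] at h
  · exact h.2 ▸ rfl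
  · obtain ⟨h, rfl⟩ := h
    exact absurd h (innerVertex_ne_outerVertex _)
  · obtain ⟨h, rfl⟩ := h
    exact absurd h.symm (innerVertex_ne_outerVertex _)
  · exact h.2 ▸ rfl
  · rw [hspider i j (Sym2.eq_iff.2 h)]

/-- The names of the edges present in the corona of the family `H`. -/
noncomputable def edges {p : ℕ} {W : Fin (3 * p) → Type*} [∀ i, Fintype (W i)]
    (H : ∀ i, SimpleGraph (W i)) : Finset (CoronaEdge W) := by
  classical
  exact Finset.univ.filter fun x => toSym2 x ∈ (spiderCorona H).edgeSet

/-- The names of the edges of the corona incident with the vertex `v`. -/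
noncomputable def incident {p : ℕ} {W : Fin (3 * p) → Type*} [∀ i, Fintype (W i)]
    (H : ∀ i, SimpleGraph (W i)) (v : SpiderVertex p ⊕ (Σ i, W i)) : Finset (CoronaEdge W) := by
  classical
  exact (edges H).filter fun x => v ∈ toSym2 x

theorem mem_edges {p : ℕ} {W : Fin (3 * p) → Type*} [∀ i, Fintype (W i)]
    {H : ∀ i, SimpleGraph (W i)} {x : CoronaEdge W} :
    x ∈ edges H ↔ toSym2 x ∈ (spiderCorona H).edgeSet := by
  simp [edges]

theorem mem_incident {p : ℕ} {W : Fin (3 * p) → Type*} [∀ i, Fintype (W i)]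
    {H : ∀ i, SimpleGraph (W i)} {v : SpiderVertex p ⊕ (Σ i, W i)} {x : CoronaEdge W} :
    x ∈ incident H v ↔ x ∈ edges H ∧ v ∈ toSym2 x := by
  simp [incident]

theorem inl_mem_edges {p : ℕ} {W : Fin (3 * p) → Type*} [∀ i, Fintype (W i)]
    {H : ∀ i, SimpleGraph (W i)} {i : Fin (3 * p)} {ε : Sym2 (W i)} :
    .inl ⟨i, ε⟩ ∈ edges H ↔ ε ∈ (H i).edgeSet := by
  rw [mem_edges]
  induction ε using Sym2.ind with
  | _ a b =>
    simp only [toSym2, Sym2.map_mk, SimpleGraph.mem_edgeSet]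
    constructor
    · rintro ⟨j, u, u', h1, h2, h⟩
      cases h1
      cases h2
      exact h
    · exact fun h => ⟨i, a, b, rfl, rfl, h⟩

theorem inr_mem_edges {p : ℕ} {W : Fin (3 * p) → Type*} [∀ i, Fintype (W i)]
    {H : ∀ i, SimpleGraph (W i)} (x : (Σ i, W i) ⊕ (Σ i, W i) ⊕ Fin (3 * p)) :
    .inr x ∈ edges H := by
  rw [mem_edges]
  rcases x with w | w | i
  · exact Sym2.mem_mk_right _ _
  · exact Sym2.mem_mk_left _ _
  · exact spiderEdge_mem i

theorem bijOn_toSym2 {p : ℕ} {W : Fin (3 * p) → Type*} [∀ i, Fintype (W i)]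
    (H : ∀ i, SimpleGraph (W i)) :
    Set.BijOn toSym2 (edges H : Set (CoronaEdge W)) (spiderCorona H).edgeSet := by
  refine ⟨fun x hx => mem_edges.1 hx, toSym2_injective.injOn, fun e he => ?_⟩
  suffices ∃ x : CoronaEdge W, toSym2 x = e by
    obtain ⟨x, rfl⟩ := this
    exact ⟨x, mem_edges.2 he, rfl⟩
  have hcross : ∀ (a : SpiderVertex p) (w : Σ i, W i), a ∈ spiderEdge w.1 →
      ∃ x : CoronaEdge W, toSym2 x = s(.inl a, .inr w) := by
    intro a w h
    rw [spiderEdge_eq, Sym2.mem_iff] at h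
    rcases h with rfl | rfl
    · exact ⟨.inr (.inr (.inl w)), rfl⟩
    · exact ⟨.inr (.inl w), rfl⟩
  induction e using Sym2.ind with
  | _ a b =>
    rcases a with a | w <;> rcases b with b | w'
    · have hab : s(a, b) ∈ (spiderGraph p).edgeSet := he
      obtain ⟨i, hi⟩ := spiderEdge_bijective.2 ⟨_, hab⟩
      refine ⟨.inr (.inr (.inr i)), ?_⟩
      have := congrArg (Sym2.map (Sum.inl (β := Σ i, W i))) (congrArg Subtype.val hi)
      exact this
    · exact hcross a w' he
    · rw [Sym2.eq_swap]
      exact hcross b w he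
    · obtain ⟨i, u, u', rfl, rfl, -⟩ := he
      exact ⟨.inl ⟨i, s(u, u')⟩, rfl⟩

/-! ### Vertex sums and degrees of the corona. -/

theorem sum_incident_inr {p : ℕ} {W : Fin (3 * p) → Type*} [∀ i, Fintype (W i)]
    [∀ i, DecidableEq (W i)]
    (H : ∀ i, SimpleGraph (W i)) [∀ i, DecidableRel (H i).Adj] (g : CoronaEdge W → ℕ)
    (i : Fin (3 * p)) (w : W i) :
    ∑ x ∈ incident H (.inr ⟨i, w⟩), g x = ∑ ε ∈ (H i).incidenceFinset w, g (.inl ⟨i, ε⟩) +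
      g (.inr (.inl ⟨i, w⟩)) + g (.inr (.inr (.inl ⟨i, w⟩))) := by
  classical
  have hinc : ∀ x, x ∈ incident H (.inr ⟨i, w⟩) ↔
      x ∈ ((H i).incidenceFinset w).image (fun ε => (.inl ⟨i, ε⟩ : CoronaEdge W)) ∪
        {.inr (.inl ⟨i, w⟩), .inr (.inr (.inl ⟨i, w⟩))} := by
    rintro (⟨j, ε⟩ | w' | w' | j)
    · rw [mem_incident, inl_mem_edges]
      simp only [toSym2, Sym2.mem_map, Sum.inr.injEq, Finset.mem_union, Finset.mem_image,
        SimpleGraph.mem_incidenceFinset, Sum.inl.injEq, Finset.mem_insert, reduceCtorEq,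
        Finset.mem_singleton, or_false, Sigma.mk.injEq]
      constructor
      · rintro ⟨h, w', hw', rfl, h'⟩
        obtain rfl := eq_of_heq h'
        exact ⟨ε, ⟨h, hw'⟩, rfl, HEq.rfl⟩
      · rintro ⟨ε', ⟨h, hw'⟩, rfl, h'⟩
        obtain rfl := eq_of_heq h'
        exact ⟨h, w, hw', rfl, HEq.rfl⟩
    · simp [mem_incident, inr_mem_edges, toSym2, eq_comm]
    · simp [mem_incident, inr_mem_edges, toSym2, eq_comm]
    · simp [mem_incident, inr_mem_edges, toSym2]
  rw [Finset.ext hinc, Finset.sum_union, Finset.sum_image, Finset.sum_pair, add_assoc]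
  · simp
  · intro a _ b _ h
    simpa using h
  · rw [Finset.disjoint_left]
    simp only [Finset.mem_image]
    rintro _ ⟨ε, -, rfl⟩
    simp

theorem sum_incident_inl {p : ℕ} {W : Fin (3 * p) → Type*} [∀ i, Fintype (W i)]
    (H : ∀ i, SimpleGraph (W i)) (g : CoronaEdge W → ℕ) (a : SpiderVertex p) :
    ∑ x ∈ incident H (.inl a), g x =
      ∑ i with outerVertex i = a,
        (∑ w, g (.inr (.inr (.inl ⟨i, w⟩))) + g (.inr (.inr (.inr i)))) +
      ∑ i with innerVertex i = a,
        (∑ w, g (.inr (.inl ⟨i, w⟩)) + g (.inr (.inr (.inr i)))) := by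
  classical
  rw [incident, edges, Finset.filter_filter, Finset.sum_filter, Fintype.sum_sum_type,
    Fintype.sum_sum_type, Fintype.sum_sum_type, Fintype.sum_sigma, Fintype.sum_sigma,
    Fintype.sum_sigma]
  have hin := fun x => (mem_edges (H := H) (x := .inr x)).1 (inr_mem_edges x)
  have h1 : ∀ (i : Fin (3 * p)) (ε : Sym2 (W i)),
      ¬ (Sum.inl a : SpiderVertex p ⊕ (Σ i, W i)) ∈ toSym2 (.inl ⟨i, ε⟩) := by
    simp [toSym2]
  have h4 : ∀ i : Fin (3 * p), ((Sum.inl a : SpiderVertex p ⊕ (Σ i, W i)) ∈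
      toSym2 (.inr (.inr (.inr i)))) ↔ outerVertex i = a ∨ innerVertex i = a := by
    simp [toSym2, eq_comm]
  have h2 : ∀ (i : Fin (3 * p)) (w : W i), ((Sum.inl a : SpiderVertex p ⊕ (Σ i, W i)) ∈
      toSym2 (.inr (.inl ⟨i, w⟩))) ↔ innerVertex i = a := by
    simp [toSym2, eq_comm]
  have h3 : ∀ (i : Fin (3 * p)) (w : W i), ((Sum.inl a : SpiderVertex p ⊕ (Σ i, W i)) ∈
      toSym2 (.inr (.inr (.inl ⟨i, w⟩)))) ↔ outerVertex i = a := by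
    simp [toSym2, eq_comm]
  -- The two ends of a spider edge differ, so the disjunction is exclusive and its indicator splits.
  have h5 : ∀ i : Fin (3 * p), (if outerVertex i = a ∨ innerVertex i = a then
      g (.inr (.inr (.inr i))) else 0) = (if outerVertex i = a then
      g (.inr (.inr (.inr i))) else 0) + (if innerVertex i = a then
      g (.inr (.inr (.inr i))) else 0) := by
    intro i
    have := innerVertex_ne_outerVertex i
    grind
  simp only [hin, true_and, h1, h2, h3, h4, h5, and_false, if_false, Finset.sum_const_zero,
    zero_add, Finset.sum_add_distrib, Finset.sum_filter]
  have h6 : ∀ (P : Fin (3 * p) → Prop) [DecidablePred P] (F : ∀ i, W i → ℕ),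
      ∑ i, ∑ w, (if P i then F i w else 0) = ∑ i, if P i then ∑ w, F i w else 0 := by
    intro P _ F
    refine Finset.sum_congr rfl fun i _ => ?_
    split_ifs <;> simp
  rw [h6, h6]
  ring

theorem sum_incident_outerVertex_of_lt {p : ℕ} {W : Fin (3 * p) → Type*} [∀ i, Fintype (W i)]
    (H : ∀ i, SimpleGraph (W i)) (g : CoronaEdge W → ℕ) {i : Fin (3 * p)} (hi : (i : ℕ) < 3) :
    ∑ x ∈ incident H (.inl (outerVertex i)), g x =
      ∑ w, g (.inr (.inr (.inl ⟨i, w⟩))) + g (.inr (.inr (.inr i))) := by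
  have h : Finset.univ.filter (fun j : Fin (3 * p) => (i : ℕ) = j + 3) = ∅ :=
    Finset.filter_false_of_mem fun j _ => by omega
  simp only [sum_incident_inl, outerVertex_injective.eq_iff, innerVertex_eq_outerVertex_iff,
    Finset.filter_eq', Finset.mem_univ, if_true, Finset.sum_singleton, h, Finset.sum_empty,
    add_zero]

theorem sum_incident_outerVertex_of_eq {p : ℕ} {W : Fin (3 * p) → Type*} [∀ i, Fintype (W i)]
    (H : ∀ i, SimpleGraph (W i)) (g : CoronaEdge W → ℕ) {i j : Fin (3 * p)}
    (hij : (i : ℕ) = j + 3) :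
    ∑ x ∈ incident H (.inl (outerVertex i)), g x =
      ∑ w, g (.inr (.inr (.inl ⟨i, w⟩))) + g (.inr (.inr (.inr i))) +
        (∑ w, g (.inr (.inl ⟨j, w⟩)) + g (.inr (.inr (.inr j)))) := by
  have h : Finset.univ.filter (fun k : Fin (3 * p) => (i : ℕ) = k + 3) = {j} := by
    ext k
    simp only [Finset.mem_filter, Finset.mem_univ, true_and, Finset.mem_singleton, Fin.ext_iff]
    omega
  simp only [sum_incident_inl, outerVertex_injective.eq_iff, innerVertex_eq_outerVertex_iff,
    Finset.filter_eq', Finset.mem_univ, if_true, Finset.sum_singleton, h]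

theorem sum_incident_none {p : ℕ} {W : Fin (3 * p) → Type*} [∀ i, Fintype (W i)]
    (H : ∀ i, SimpleGraph (W i)) (g : CoronaEdge W → ℕ) :
    ∑ x ∈ incident H (.inl none), g x = ∑ i ∈ Finset.univ.filter fun i : Fin (3 * p) => 3 * p ≤ i + 3,
        (∑ w, g (.inr (.inl ⟨i, w⟩)) + g (.inr (.inr (.inr i)))) := by
  simp [sum_incident_inl, innerVertex_eq_none_iff, outerVertex_ne_none]

theorem sum_incidenceFinset_eq {p : ℕ} {W : Fin (3 * p) → Type*} [∀ i, Fintype (W i)]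
    [DecidableEq (SpiderVertex p ⊕ (Σ i, W i))]
    (H : ∀ i, SimpleGraph (W i)) (f : Sym2 (SpiderVertex p ⊕ (Σ i, W i)) → ℕ)
    (v : SpiderVertex p ⊕ (Σ i, W i)) [Fintype ((spiderCorona H).neighborSet v)] :
    ∑ e ∈ (spiderCorona H).incidenceFinset v, f e = ∑ x ∈ incident H v, f (toSym2 x) := by
  have : (spiderCorona H).incidenceFinset v = (incident H v).image toSym2 := by
    ext e
    rw [SimpleGraph.mem_incidenceFinset, Finset.mem_image]
    constructor
    · rintro ⟨he, hv⟩
      obtain ⟨x, hx, rfl⟩ := (bijOn_toSym2 H).surjOn he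
      exact ⟨x, mem_incident.2 ⟨hx, hv⟩, rfl⟩
    · rintro ⟨_, hx, rfl⟩
      obtain ⟨h1, h2⟩ := mem_incident.1 hx
      exact ⟨mem_edges.1 h1, h2⟩
  rw [this, Finset.sum_image toSym2_injective.injOn]

/-- A degree is a vertex sum for the constant label `1`, so the formulas for vertex sums also
compute degrees. -/
theorem coronaDegree_eq {p : ℕ} {W : Fin (3 * p) → Type*} [∀ i, Fintype (W i)]
    (H : ∀ i, SimpleGraph (W i)) (v : SpiderVertex p ⊕ (Σ i, W i)) :
    coronaDegree H v = ∑ _x ∈ incident H v, 1 := by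
  classical
  rw [← sum_incidenceFinset_eq H (fun _ => 1), ← Finset.card_eq_sum_ones,
    SimpleGraph.card_incidenceFinset_eq_degree, coronaDegree]

theorem isAntimagic {p : ℕ} {W : Fin (3 * p) → Type*} [∀ i, Fintype (W i)]
    (H : ∀ i, SimpleGraph (W i)) (g : CoronaEdge W → ℕ)
    (hg : Set.BijOn g (edges H) (Set.Icc 1 (edges H).card))
    (hinj : Function.Injective fun v => ∑ x ∈ incident H v, g x) :
    IsAntimagic (spiderCorona H) := by
  classical
  obtain ⟨f, hf⟩ : ∃ f : Sym2 (SpiderVertex p ⊕ (Σ i, W i)) → ℕ, ∀ x, f (toSym2 x) = g x :=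
    ⟨Function.extend toSym2 g 0, toSym2_injective.extend_apply g 0⟩
  have hedge : (spiderCorona H).edgeFinset = (edges H).image toSym2 := by
    rw [← Finset.coe_inj, SimpleGraph.coe_edgeFinset, Finset.coe_image, (bijOn_toSym2 H).image_eq]
  have hcard : (spiderCorona H).edgeFinset.card = (edges H).card := by
    rw [hedge, Finset.card_image_of_injective _ toSym2_injective]
  refine ⟨f, ?_, ?_⟩
  · rw [hcard, ← (bijOn_toSym2 H).image_eq]
    refine ⟨?_, ?_, ?_⟩
    · rintro _ ⟨x, hx, rfl⟩
      rw [hf]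
      exact hg.mapsTo hx
    · rintro _ ⟨x, hx, rfl⟩ _ ⟨y, hy, rfl⟩ hxy
      rw [hf, hf] at hxy
      rw [hg.injOn hx hy hxy]
    · intro n hn
      obtain ⟨x, hx, rfl⟩ := hg.surjOn hn
      exact ⟨_, ⟨x, hx, rfl⟩, hf x⟩
  · simpa only [sum_incidenceFinset_eq, hf] using hinj

end CoronaEdge

open Finset in
theorem Finset.sum_lt_sum_of_card_le_of_forall_lt {ι κ : Type*} {s : Finset ι} {t : Finset κ}
    {f : ι → ℕ} {g : κ → ℕ} (hs : s.Nonempty) (hcard : #s ≤ #t)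
    (h : ∀ a ∈ s, ∀ b ∈ t, f a < g b) : ∑ a ∈ s, f a < ∑ b ∈ t, g b := by
  -- The weak inequality for `f + 1` gains `#s`, which is positive.
  have h1 : ∑ a ∈ s, (f a + 1) ≤ ∑ b ∈ t, g b := sum_le_sum_of_card_le_of_forall_le hcard h
  rw [sum_add_distrib, ← card_eq_sum_ones] at h1
  have := hs.card_pos
  omega

/-! ### The order of labeling, and the highest edge at each vertex. -/

namespace CoronaEdge

/-- The position of the block of edges of kind `c` belonging to the `i`-th edge of the spider in
the order of labeling; the kinds are `0` (edges of `H i`), `1` (edges to the inner end),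
`2` (edges to the outer end) and `3` (the spider edge). -/
def blockRank (p c i : ℕ) : ℕ :=
  if i < 3 then 4 * i + c
  else if i + 3 < 3 * p then 12 + c * (3 * p) + i
  -- The earlier ranks are all below `12 * p + 12`. The parity puts inner edges and spider edges
  -- into one final block, common to the three groups at the centre, so that tie-breaking applies
  -- across all of them.
  else 12 * p + 12 + c % 2

/-- The block of an edge of the corona in the order of labeling. -/
def rank {p : ℕ} {W : Fin (3 * p) → Type*} : CoronaEdge W → ℕ
  | .inl x => blockRank p 0 x.1
  | .inr (.inl x) => blockRank p 1 x.1
  | .inr (.inr (.inl x)) => blockRank p 2 x.1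
  | .inr (.inr (.inr i)) => blockRank p 3 i

/-- The vertex whose partial sum decides the order of an edge within its block. -/
def anchor {p : ℕ} {W : Fin (3 * p) → Type*} : CoronaEdge W → SpiderVertex p ⊕ (Σ i, W i)
  -- A dummy value: edges of `H i` are not incident with the centre, so the tie-breaking conclusion
  -- is never invoked for them.
  | .inl _ => .inl none
  | .inr (.inl w) => .inr w
  | .inr (.inr (.inl w)) => .inr w
  | .inr (.inr (.inr i)) => .inl (outerVertex i)

theorem eq_of_mem_incident_inr {p : ℕ} {W : Fin (3 * p) → Type*} [∀ i, Fintype (W i)]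
    {H : ∀ i, SimpleGraph (W i)} {w : Σ i, W i} {x : CoronaEdge W}
    (hx : x ∈ incident H (.inr w)) :
    (∃ ε, x = .inl ⟨w.1, ε⟩) ∨ x = .inr (.inl w) ∨ x = .inr (.inr (.inl w)) := by
  rw [mem_incident] at hx
  have h := hx.2
  rcases x with ⟨j, ε⟩ | w' | w' | j
  · simp only [toSym2, Sym2.mem_map, Sum.inr.injEq] at h
    obtain ⟨a, -, rfl⟩ := h
    exact Or.inl ⟨ε, rfl⟩
  · simp_all [toSym2]
  · simp_all [toSym2]
  · simp [toSym2] at h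

theorem eq_of_mem_incident_outerVertex {p : ℕ} {W : Fin (3 * p) → Type*} [∀ i, Fintype (W i)]
    {H : ∀ i, SimpleGraph (W i)} {i : Fin (3 * p)} {x : CoronaEdge W}
    (hx : x ∈ incident H (.inl (outerVertex i))) :
    x = .inr (.inr (.inr i)) ∨ (∃ w, x = .inr (.inr (.inl ⟨i, w⟩))) ∨
      ∃ j : Fin (3 * p), (i : ℕ) = j + 3 ∧
        ((∃ w, x = .inr (.inl ⟨j, w⟩)) ∨ x = .inr (.inr (.inr j))) := by
  rw [mem_incident] at hx
  have h := hx.2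
  rcases x with ⟨j, ε⟩ | ⟨j, w⟩ | ⟨j, w⟩ | j
  · simp [toSym2] at h
  · simp only [toSym2, Sym2.mem_iff, Sum.inl.injEq, reduceCtorEq, or_false] at h
    exact Or.inr (Or.inr ⟨j, innerVertex_eq_outerVertex_iff.1 h.symm, Or.inl ⟨w, rfl⟩⟩)
  · simp only [toSym2, Sym2.mem_iff, Sum.inl.injEq, reduceCtorEq, or_false,
      outerVertex_injective.eq_iff] at h
    subst h
    exact Or.inr (Or.inl ⟨w, rfl⟩)
  · simp only [toSym2, Sym2.mem_iff, Sum.inl.injEq, outerVertex_injective.eq_iff] at h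
    rcases h with rfl | h
    · exact Or.inl rfl
    · exact Or.inr (Or.inr ⟨j, innerVertex_eq_outerVertex_iff.1 h.symm, Or.inr rfl⟩)

theorem mem_incident_inner {p : ℕ} {W : Fin (3 * p) → Type*} [∀ i, Fintype (W i)]
    (H : ∀ i, SimpleGraph (W i)) (w : Σ i, W i) :
    .inr (.inl w) ∈ incident H (.inr w) :=
  mem_incident.2 ⟨inr_mem_edges _, Sym2.mem_mk_right _ _⟩

theorem mem_incident_outer {p : ℕ} {W : Fin (3 * p) → Type*} [∀ i, Fintype (W i)]
    (H : ∀ i, SimpleGraph (W i)) (w : Σ i, W i) :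
    .inr (.inr (.inl w)) ∈ incident H (.inr w) :=
  mem_incident.2 ⟨inr_mem_edges _, Sym2.mem_mk_right _ _⟩

theorem mem_incident_outerVertex {p : ℕ} {W : Fin (3 * p) → Type*} [∀ i, Fintype (W i)]
    (H : ∀ i, SimpleGraph (W i)) (i : Fin (3 * p)) :
    .inr (.inr (.inr i)) ∈ incident H (.inl (outerVertex i)) :=
  mem_incident.2 ⟨inr_mem_edges _, Sym2.mem_mk_left _ _⟩

theorem rank_le_of_mem_incident_outerVertex {p : ℕ} {W : Fin (3 * p) → Type*}
    [∀ i, Fintype (W i)] {H : ∀ i, SimpleGraph (W i)} {i : Fin (3 * p)} {x : CoronaEdge W}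
    (hx : x ∈ incident H (.inl (outerVertex i))) (hi : (i : ℕ) + 3 < 3 * p) :
    rank x ≤ blockRank p 3 i := by
  rcases eq_of_mem_incident_outerVertex hx with rfl | ⟨w, rfl⟩ | ⟨j, hj, ⟨w, rfl⟩ | rfl⟩ <;>
  · simp only [rank, blockRank]
    split_ifs <;> omega

theorem le_rank_of_mem_incident_inr {p : ℕ} {W : Fin (3 * p) → Type*}
    [∀ i, Fintype (W i)] {H : ∀ i, SimpleGraph (W i)} {w : Σ i, W i} {x : CoronaEdge W}
    (hx : x ∈ incident H (.inr w)) : blockRank p 0 w.1 ≤ rank x := by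
  rcases eq_of_mem_incident_inr hx with ⟨ε, rfl⟩ | rfl | rfl <;>
  · simp only [rank, blockRank]
    split_ifs <;> omega

/-- Away from the centre the outer edge is the unique highest edge at a vertex of `H i`, as
tie-breaking requires. -/
theorem rank_lt_outer {p : ℕ} {W : Fin (3 * p) → Type*}
    [∀ i, Fintype (W i)] {H : ∀ i, SimpleGraph (W i)} {w : Σ i, W i} {x : CoronaEdge W}
    (hw : (w.1 : ℕ) + 3 < 3 * p) (hx : x ∈ incident H (.inr w))
    (hne : x ≠ .inr (.inr (.inl w))) : rank x < rank (.inr (.inr (.inl w)) : CoronaEdge W) := by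
  rcases eq_of_mem_incident_inr hx with ⟨ε, rfl⟩ | rfl | rfl
  · simp only [rank, blockRank]
    split_ifs <;> omega
  · simp only [rank, blockRank]
    split_ifs <;> omega
  · exact absurd rfl hne

/-- At the centre the roles are reversed: the inner edge alone lies in the final block. -/
theorem rank_lt_inner {p : ℕ} {W : Fin (3 * p) → Type*}
    [∀ i, Fintype (W i)] {H : ∀ i, SimpleGraph (W i)} {w : Σ i, W i} {x : CoronaEdge W}
    (hw : 3 * p ≤ (w.1 : ℕ) + 3) (h3 : 3 ≤ (w.1 : ℕ)) (hx : x ∈ incident H (.inr w))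
    (hne : x ≠ .inr (.inl w)) : rank x < rank (.inr (.inl w) : CoronaEdge W) := by
  rcases eq_of_mem_incident_inr hx with ⟨ε, rfl⟩ | rfl | rfl
  · simp only [rank, blockRank]
    split_ifs <;> omega
  · exact absurd rfl hne
  · simp only [rank, blockRank]
    split_ifs <;> omega

/-- The outer edges at this vertex lie one block lower, and the edges coming from the preceding
spider edge belong to a group labeled earlier. -/
theorem rank_lt_spider {p : ℕ} {W : Fin (3 * p) → Type*}
    [∀ i, Fintype (W i)] {H : ∀ i, SimpleGraph (W i)} {i : Fin (3 * p)} {x : CoronaEdge W}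
    (hi : 3 * p ≤ (i : ℕ) + 3) (h3 : 3 ≤ (i : ℕ)) (hx : x ∈ incident H (.inl (outerVertex i)))
    (hne : x ≠ .inr (.inr (.inr i))) : rank x < rank (.inr (.inr (.inr i)) : CoronaEdge W) := by
  have := i.2
  rcases eq_of_mem_incident_outerVertex hx with rfl | ⟨w, rfl⟩ | ⟨j, hj, ⟨w, rfl⟩ | rfl⟩
  · exact absurd rfl hne
  all_goals
    simp only [rank, blockRank]
    split_ifs <;> omega

end CoronaEdge

/-! ### Comparison of sums by domination. -/

namespace CoronaEdge

/-- The sum of the labels `g` at the vertex `v` of the corona. -/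
noncomputable def weight {p : ℕ} {W : Fin (3 * p) → Type*} [∀ i, Fintype (W i)]
    (H : ∀ i, SimpleGraph (W i)) (g : CoronaEdge W → ℕ) (v : SpiderVertex p ⊕ (Σ i, W i)) : ℕ :=
  ∑ x ∈ incident H v, g x

/-- The labels `g` increase with the rank of the edges. -/
def RankMono {p : ℕ} {W : Fin (3 * p) → Type*} [∀ i, Fintype (W i)]
    (H : ∀ i, SimpleGraph (W i)) (g : CoronaEdge W → ℕ) : Prop :=
  ∀ a ∈ edges H, ∀ b ∈ edges H, rank a < rank b → g a < g b

section Comparison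

variable {p : ℕ} {W : Fin (3 * p) → Type*} [∀ i, Fintype (W i)] {H : ∀ i, SimpleGraph (W i)}
  {g : CoronaEdge W → ℕ}

theorem RankMono.inr_lt (hg : RankMono H g) (x y : (Σ i, W i) ⊕ (Σ i, W i) ⊕ Fin (3 * p))
    (h : rank (.inr x : CoronaEdge W) < rank (.inr y : CoronaEdge W)) : g (.inr x) < g (.inr y) :=
  hg _ (inr_mem_edges x) _ (inr_mem_edges y) h

/-- Every label at the spider vertex is below every label at `w`, so comparing the degrees suffices.
-/
theorem weight_outerVertex_lt_weight_inr (hg : RankMono H g) {i j : Fin (3 * p)} {w : W j}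
    (hi : (i : ℕ) + 3 < 3 * p) (hij : blockRank p 3 i < blockRank p 0 j)
    (hdeg : coronaDegree H (.inl (outerVertex i)) ≤ coronaDegree H (.inr ⟨j, w⟩)) :
    weight H g (.inl (outerVertex i)) < weight H g (.inr ⟨j, w⟩) := by
  rw [coronaDegree_eq, coronaDegree_eq, ← Finset.card_eq_sum_ones,
    ← Finset.card_eq_sum_ones] at hdeg
  refine Finset.sum_lt_sum_of_card_le_of_forall_lt ⟨_, mem_incident_outerVertex H i⟩ hdeg
    fun a ha b hb => hg a (mem_incident.1 ha).1 b (mem_incident.1 hb).1 ?_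
  exact (rank_le_of_mem_incident_outerVertex ha hi).trans_lt
    (hij.trans_le (le_rank_of_mem_incident_inr hb))

theorem le_weight_outerVertex (H : ∀ i, SimpleGraph (W i)) (g : CoronaEdge W → ℕ)
    (i : Fin (3 * p)) :
    ∑ w, g (.inr (.inr (.inl ⟨i, w⟩))) + g (.inr (.inr (.inr i))) ≤
      weight H g (.inl (outerVertex i)) := by
  rw [weight]
  by_cases hi : (i : ℕ) < 3
  · exact (sum_incident_outerVertex_of_lt H g hi).ge
  · rw [sum_incident_outerVertex_of_eq H g (j := ⟨i - 3, by omega⟩) (by simp; omega)]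
    exact Nat.le_add_right _ _

/-- The sums compare kind by kind: outer edges, spider edge, and the inner edges and spider edge of
the preceding groups. A tip has no preceding group, so there the first two kinds suffice. -/
theorem weight_outerVertex_lt_weight_outerVertex (hg : RankMono H g) {i j : Fin (3 * p)}
    (hij : i < j) (hi : (i : ℕ) + 3 < 3 * p)
    (hcard : ∀ i j : Fin (3 * p), i ≤ j → Fintype.card (W i) ≤ Fintype.card (W j)) :
    weight H g (.inl (outerVertex i)) < weight H g (.inl (outerVertex j)) := by
  have hj := j.2
  have hij' := Fin.lt_def.1 hij
  have h1 : ∑ w, g (.inr (.inr (.inl ⟨i, w⟩))) ≤ ∑ w, g (.inr (.inr (.inl ⟨j, w⟩))) :=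
    Finset.sum_le_sum_of_card_le_of_forall_le (hcard i j hij.le)
      fun a _ b _ => (hg.inr_lt _ _ (by
        simp only [rank, blockRank]
        split_ifs <;> omega)).le
  have h2 := hg.inr_lt (.inr (.inr i)) (.inr (.inr j)) (by
    simp only [rank, blockRank]
    split_ifs <;> omega)
  by_cases hi3 : (i : ℕ) < 3
  · refine lt_of_lt_of_le ?_ (le_weight_outerVertex H g j)
    rw [weight, sum_incident_outerVertex_of_lt H g hi3]
    omega
  · obtain ⟨i', hi'⟩ : ∃ i' : Fin (3 * p), (i : ℕ) = i' + 3 :=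
      ⟨⟨i - 3, by omega⟩, by simp only; omega⟩
    obtain ⟨j', hj'⟩ : ∃ j' : Fin (3 * p), (j : ℕ) = j' + 3 :=
      ⟨⟨j - 3, by omega⟩, by simp only; omega⟩
    rw [weight, weight, sum_incident_outerVertex_of_eq H g hi',
      sum_incident_outerVertex_of_eq H g hj']
    have h3 : ∑ w, g (.inr (.inl ⟨i', w⟩)) ≤ ∑ w, g (.inr (.inl ⟨j', w⟩)) :=
      Finset.sum_le_sum_of_card_le_of_forall_le (hcard i' j' (Fin.le_def.2 (by omega)))
        fun a _ b _ => (hg.inr_lt _ _ (by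
          simp only [rank, blockRank]
          split_ifs <;> omega)).le
    have h4 := hg.inr_lt (.inr (.inr i')) (.inr (.inr j')) (by
      simp only [rank, blockRank]
      split_ifs <;> omega)
    omega

theorem le_weight_none (H : ∀ i, SimpleGraph (W i)) (g : CoronaEdge W → ℕ)
    (s : Finset (Fin (3 * p))) (hs : ∀ i ∈ s, 3 * p ≤ (i : ℕ) + 3) :
    ∑ i ∈ s, (∑ w, g (.inr (.inl ⟨i, w⟩)) + g (.inr (.inr (.inr i)))) ≤
      weight H g (.inl none) := by
  rw [weight, sum_incident_none]
  exact Finset.sum_le_sum_of_subset fun i hi =>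
    Finset.mem_filter.2 ⟨Finset.mem_univ _, hs i hi⟩

/-- Two of the three groups at the centre are enough. The group of `i` shares its spider edge, and
its inner edges dominate its outer edges; a second group `j` dominates the one preceding `i`. -/
theorem weight_outerVertex_lt_weight_none (hg : RankMono H g) {i : Fin (3 * p)}
    (hi : 3 * p ≤ (i : ℕ) + 3) (hp : 2 < p)
    (hcard : ∀ i j : Fin (3 * p), i ≤ j → Fintype.card (W i) ≤ Fintype.card (W j)) :
    weight H g (.inl (outerVertex i)) < weight H g (.inl none) := by
  have hi2 := i.2
  obtain ⟨j, hj, hji⟩ : ∃ j : Fin (3 * p), 3 * p ≤ (j : ℕ) + 3 ∧ i ≠ j := by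
    by_cases h : (i : ℕ) + 1 = 3 * p
    · exact ⟨⟨i - 1, by omega⟩, by simp only; omega, by rw [Ne, Fin.ext_iff]; simp only; omega⟩
    · exact ⟨⟨i + 1, by omega⟩, by simp only; omega, by rw [Ne, Fin.ext_iff]; simp only; omega⟩
  obtain ⟨i', hi'⟩ : ∃ i' : Fin (3 * p), (i : ℕ) = i' + 3 :=
    ⟨⟨i - 3, by omega⟩, by simp only; omega⟩
  refine lt_of_lt_of_le ?_ (le_weight_none H g {i, j} (by simp [hi, hj]))
  rw [weight, sum_incident_outerVertex_of_eq H g hi', Finset.sum_pair hji]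
  have h1 : ∑ w, g (.inr (.inr (.inl ⟨i, w⟩))) ≤ ∑ w, g (.inr (.inl ⟨i, w⟩)) :=
    Finset.sum_le_sum_of_card_le_of_forall_le le_rfl fun a _ b _ => (hg.inr_lt _ _ (by
      simp only [rank, blockRank]
      split_ifs <;> omega)).le
  have h2 : ∑ w, g (.inr (.inl ⟨i', w⟩)) ≤ ∑ w, g (.inr (.inl ⟨j, w⟩)) :=
    Finset.sum_le_sum_of_card_le_of_forall_le (hcard i' j (Fin.le_def.2 (by omega)))
      fun a _ b _ => (hg.inr_lt _ _ (by
        simp only [rank, blockRank]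
        split_ifs <;> omega)).le
  have h3 := hg.inr_lt (.inr (.inr i')) (.inr (.inr j)) (by
    simp only [rank, blockRank]
    split_ifs <;> omega)
  omega

variable [∀ i, DecidableRel (H i).Adj]

theorem inl_mem_edges_of_mem_incidenceFinset [∀ i, DecidableEq (W i)] {i : Fin (3 * p)} {w : W i}
    {ε : Sym2 (W i)} (h : ε ∈ (H i).incidenceFinset w) : .inl ⟨i, ε⟩ ∈ edges H :=
  inl_mem_edges.2 (((H i).mem_incidenceFinset _ _).1 h).1

theorem weight_inr_lt_weight_inr (hg : RankMono H g) {i j : Fin (3 * p)} (hij : i < j)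
    (hi : (i : ℕ) + 3 < 3 * p) {w : W i} {w' : W j} (hdeg : (H i).degree w ≤ (H j).degree w') :
    weight H g (.inr ⟨i, w⟩) < weight H g (.inr ⟨j, w'⟩) := by
  classical
  rw [Fin.lt_def] at hij
  rw [weight, weight, sum_incident_inr, sum_incident_inr]
  have h1 : ∑ ε ∈ (H i).incidenceFinset w, g (.inl ⟨i, ε⟩) ≤
      ∑ ε ∈ (H j).incidenceFinset w', g (.inl ⟨j, ε⟩) := by
    refine Finset.sum_le_sum_of_card_le_of_forall_le ?_ fun a ha b hb => (hg _
      (inl_mem_edges_of_mem_incidenceFinset ha) _ (inl_mem_edges_of_mem_incidenceFinset hb) ?_).le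
    · simpa only [SimpleGraph.card_incidenceFinset_eq_degree] using hdeg
    · simp only [rank, blockRank]
      split_ifs <;> omega
  have h2 := hg.inr_lt (.inl ⟨i, w⟩) (.inl ⟨j, w'⟩) (by
    simp only [rank, blockRank]
    split_ifs <;> omega)
  have h3 := hg.inr_lt (.inr (.inl ⟨i, w⟩)) (.inr (.inl ⟨j, w'⟩)) (by
    simp only [rank, blockRank]
    split_ifs <;> omega)
  omega

/-- One summand `F w'` is set aside to absorb `m`; at least `(H i).degree w` summands remain to
absorb the labels of the edges of `H i` at `w`. -/
theorem sum_incidenceFinset_add_le_sum [∀ i, DecidableEq (W i)] {i j : Fin (3 * p)} {w : W i}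
    {F : W j → ℕ} (w' : W j) {m : ℕ} (hdeg : (H i).degree w + 1 ≤ Fintype.card (W j))
    (hm : m ≤ F w') (h : ∀ ε ∈ (H i).incidenceFinset w, ∀ u, g (.inl ⟨i, ε⟩) ≤ F u) :
    ∑ ε ∈ (H i).incidenceFinset w, g (.inl ⟨i, ε⟩) + m ≤ ∑ u, F u := by
  rw [← Finset.sum_erase_add _ _ (Finset.mem_univ w')]
  refine add_le_add (Finset.sum_le_sum_of_card_le_of_forall_le ?_ fun a ha b _ => h a ha b) hm
  rw [SimpleGraph.card_incidenceFinset_eq_degree, Finset.card_erase_of_mem (Finset.mem_univ w'),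
    Finset.card_univ]
  omega

/-- The outer edge of `w` is common to both sums, the other outer edges absorb the edges of `H i` at
`w`, and the spider edge beats the inner edge. -/
theorem weight_inr_lt_weight_outerVertex_self (hg : RankMono H g) {i : Fin (3 * p)}
    (hi : (i : ℕ) < 3) (w : W i) :
    weight H g (.inr ⟨i, w⟩) < weight H g (.inl (outerVertex i)) := by
  classical
  rw [weight, weight, sum_incident_inr, sum_incident_outerVertex_of_lt H g hi]
  have h1 := sum_incidenceFinset_add_le_sum (H := H) (g := g)
    (F := fun u => g (.inr (.inr (.inl ⟨i, u⟩)))) w ((H i).degree_lt_card_verts w) le_rfl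
    fun ε hε u => (hg _ (inl_mem_edges_of_mem_incidenceFinset hε) _ (inr_mem_edges _) (by
      simp only [rank, blockRank]
      split_ifs <;> omega)).le
  have h2 := hg.inr_lt (.inl ⟨i, w⟩) (.inr (.inr i)) (by
    simp only [rank, blockRank]
    rw [if_pos hi, if_pos hi]
    omega)
  omega

/-- The outer edges of group `j` absorb the inner edge and the edges of `H i` at `w`; the spider
edge `j` beats the outer edge of `w`. -/
theorem weight_inr_lt_weight_outerVertex (hg : RankMono H g) {i j : Fin (3 * p)}
    (hi : (i : ℕ) + 3 < 3 * p) (hj : 3 ≤ (j : ℕ)) {w : W i} (w' : W j)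
    (hdeg : (H i).degree w + 1 ≤ Fintype.card (W j)) :
    weight H g (.inr ⟨i, w⟩) < weight H g (.inl (outerVertex j)) := by
  classical
  refine lt_of_lt_of_le ?_ (le_weight_outerVertex H g j)
  have := i.2
  have := j.2
  rw [weight, sum_incident_inr]
  have h1 := sum_incidenceFinset_add_le_sum (H := H) (g := g)
    (F := fun u => g (.inr (.inr (.inl ⟨j, u⟩)))) w' (m := g (.inr (.inl ⟨i, w⟩))) hdeg
    (hg.inr_lt _ _ (by
      simp only [rank, blockRank]
      split_ifs <;> omega)).le
    fun ε hε u => (hg _ (inl_mem_edges_of_mem_incidenceFinset hε) _ (inr_mem_edges _) (by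
      simp only [rank, blockRank]
      split_ifs <;> omega)).le
  have h2 := hg.inr_lt (.inr (.inl ⟨i, w⟩)) (.inr (.inr j)) (by
    simp only [rank, blockRank]
    split_ifs <;> omega)
  omega

/-- The inner edges of group `i` contain that of `w` and absorb the edges of `H i` at `w`; the
spider edge beats the outer edge. -/
theorem weight_inr_lt_weight_none (hg : RankMono H g) {i : Fin (3 * p)}
    (hi : 3 * p ≤ (i : ℕ) + 3) (hi3 : 3 ≤ (i : ℕ)) (w : W i) :
    weight H g (.inr ⟨i, w⟩) < weight H g (.inl none) := by
  classical
  refine lt_of_lt_of_le ?_ (le_weight_none H g {i} (by simpa using hi))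
  rw [weight, sum_incident_inr, Finset.sum_singleton]
  have h1 := sum_incidenceFinset_add_le_sum (H := H) (g := g)
    (F := fun u => g (.inr (.inl ⟨i, u⟩))) w ((H i).degree_lt_card_verts w) le_rfl
    fun ε hε u => (hg _ (inl_mem_edges_of_mem_incidenceFinset hε) _ (inr_mem_edges _) (by
      simp only [rank, blockRank]
      split_ifs <;> omega)).le
  have h2 := hg.inr_lt (.inr (.inl ⟨i, w⟩)) (.inr (.inr i)) (by
    simp only [rank, blockRank]
    split_ifs <;> omega)
  omega

end Comparison

/-! ### Distinctness of all vertex sums. -/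

theorem weight_injective {p : ℕ} (hp : 2 < p) {W : Fin (3 * p) → Type*} [∀ i, Fintype (W i)]
    {H : ∀ i, SimpleGraph (W i)} [∀ i, DecidableRel (H i).Adj] [∀ i, Nonempty (W i)]
    {g : CoronaEdge W → ℕ} (hg : RankMono H g)
    (htie : ∀ a ∈ incident H (anchor a), ∀ b ∈ incident H (anchor b), anchor a ≠ anchor b →
      rank a = rank b → (∀ x ∈ incident H (anchor a), x ≠ a → rank x < rank a) →
      (∀ x ∈ incident H (anchor b), x ≠ b → rank x < rank b) →
      weight H g (anchor a) ≠ weight H g (anchor b))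
    (hcard : ∀ i j : Fin (3 * p), i ≤ j → Fintype.card (W i) ≤ Fintype.card (W j))
    (hdeg : ∀ i j : Fin (3 * p), i < j → ∀ (w : W i) (w' : W j),
      (H i).degree w ≤ (H j).degree w')
    (hdegcard : ∀ i j : Fin (3 * p), (i : ℕ) + 3 < 3 * p → 3 ≤ (j : ℕ) → ∀ w : W i,
      (H i).degree w + 1 ≤ Fintype.card (W j))
    (htip : ∀ i j : Fin (3 * p), (i : ℕ) < 3 → i < j → ∀ w : W j,
      coronaDegree H (.inl (outerVertex i)) ≤ coronaDegree H (.inr ⟨j, w⟩))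
    (hmid : ∀ i j : Fin (3 * p), (i : ℕ) + 3 < 3 * p → 3 * p ≤ (j : ℕ) + 3 → ∀ w : W j,
      coronaDegree H (.inl (outerVertex i)) ≤ coronaDegree H (.inr ⟨j, w⟩)) :
    Function.Injective (weight H g) := by
  have hOO : ∀ i j : Fin (3 * p), i < j →
      weight H g (.inl (outerVertex i)) ≠ weight H g (.inl (outerVertex j)) := by
    intro i j hij
    have hij' := Fin.lt_def.1 hij
    by_cases hi : (i : ℕ) + 3 < 3 * p
    · exact (weight_outerVertex_lt_weight_outerVertex hg hij hi hcard).ne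
    -- Both vertices are neighbours of the centre, with highest edges in the final block.
    · refine htie (.inr (.inr (.inr i))) (mem_incident_outerVertex H i) (.inr (.inr (.inr j)))
        (mem_incident_outerVertex H j) ?_ ?_ (fun x => rank_lt_spider (by omega) (by omega))
        (fun x => rank_lt_spider (by omega) (by omega))
      · simpa [anchor, outerVertex_injective.eq_iff] using hij.ne
      · simp only [rank, blockRank]
        split_ifs <;> omega
  have hHH : ∀ (i j : Fin (3 * p)) (w : W i) (w' : W j), i ≤ j →
      (Sum.inr ⟨i, w⟩ : SpiderVertex p ⊕ (Σ i, W i)) ≠ .inr ⟨j, w'⟩ →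
      weight H g (.inr ⟨i, w⟩) ≠ weight H g (.inr ⟨j, w'⟩) := by
    intro i j w w' hij hne
    have hij' := Fin.le_def.1 hij
    by_cases hi : (i : ℕ) + 3 < 3 * p
    · rcases hij.lt_or_eq with h | rfl
      · exact (weight_inr_lt_weight_inr hg h hi (hdeg i j h w w')).ne
      · exact htie (.inr (.inr (.inl ⟨i, w⟩))) (mem_incident_outer H _) (.inr (.inr (.inl ⟨i, w'⟩)))
          (mem_incident_outer H _) hne rfl (fun x => rank_lt_outer hi) (fun x => rank_lt_outer hi)
    · refine htie (.inr (.inl ⟨i, w⟩)) (mem_incident_inner H _) (.inr (.inl ⟨j, w'⟩))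
        (mem_incident_inner H _) hne ?_
        (fun x => rank_lt_inner (by simp only; omega) (by simp only; omega))
        (fun x => rank_lt_inner (by simp only; omega) (by simp only; omega))
      simp only [rank, blockRank]
      split_ifs <;> omega
  have hOH : ∀ (i j : Fin (3 * p)) (w : W j),
      weight H g (.inl (outerVertex i)) ≠ weight H g (.inr ⟨j, w⟩) := by
    intro i j w
    by_cases hj : (j : ℕ) + 3 < 3 * p
    · by_cases hi3 : (i : ℕ) < 3
      · rcases lt_trichotomy i j with h | rfl | h
        · refine (weight_outerVertex_lt_weight_inr hg (by omega) ?_ (htip i j hi3 h w)).ne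
          rw [Fin.lt_def] at h
          simp only [blockRank]
          split_ifs <;> omega
        · exact (weight_inr_lt_weight_outerVertex_self hg hi3 w).ne'
        · have h' := Fin.lt_def.1 h
          exact ((weight_inr_lt_weight_outerVertex_self hg (by omega) w).trans
            (weight_outerVertex_lt_weight_outerVertex hg h hj hcard)).ne'
      · exact (weight_inr_lt_weight_outerVertex hg hj (by omega) (Classical.arbitrary (W i))
          (hdegcard j i hj (by omega) w)).ne'
    · by_cases hi : (i : ℕ) + 3 < 3 * p
      · refine (weight_outerVertex_lt_weight_inr hg hi ?_ (hmid i j hi (by omega) w)).ne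
        simp only [blockRank]
        split_ifs <;> omega
      -- A spider edge and an inner edge compete in the same final block, so a spider vertex is
      -- separated from a vertex of `H j` by tie-breaking too.
      · refine htie (.inr (.inr (.inr i))) (mem_incident_outerVertex H i) (.inr (.inl ⟨j, w⟩))
          (mem_incident_inner H _) (by simp [anchor]) ?_
          (fun x => rank_lt_spider (by omega) (by omega))
          (fun x => rank_lt_inner (by simp only; omega) (by simp only; omega))
        simp only [rank, blockRank]
        split_ifs <;> omega
  have hO : ∀ i, weight H g (.inl (outerVertex i)) < weight H g (.inl none) := by
    intro i
    by_cases hi : (i : ℕ) + 3 < 3 * p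
    · refine (weight_outerVertex_lt_weight_outerVertex hg (j := ⟨3 * p - 1, by omega⟩) ?_ hi
        hcard).trans (weight_outerVertex_lt_weight_none hg ?_ hp hcard)
      · rw [Fin.lt_def]
        simp only
        omega
      · simp only
        omega
    · exact weight_outerVertex_lt_weight_none hg (by omega) hp hcard
  have hH : ∀ (i : Fin (3 * p)) (w : W i),
      weight H g (.inr ⟨i, w⟩) < weight H g (.inl none) := by
    intro i w
    by_cases hi : (i : ℕ) + 3 < 3 * p
    · have hlast : (3 : ℕ) ≤ (⟨3 * p - 1, by omega⟩ : Fin (3 * p)) := by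
        simp only
        omega
      exact (weight_inr_lt_weight_outerVertex hg hi hlast (Classical.arbitrary _)
        (hdegcard i _ hi hlast w)).trans (hO _)
    · exact weight_inr_lt_weight_none hg (by omega) (by omega) w
  rintro (a | ⟨i, w⟩) (b | ⟨j, w'⟩) h
  · by_cases ha : a = none <;> by_cases hb : b = none
    · rw [ha, hb]
    · obtain ⟨i, rfl⟩ := exists_outerVertex hb
      subst ha
      exact absurd h (hO i).ne'
    · obtain ⟨i, rfl⟩ := exists_outerVertex ha
      subst hb
      exact absurd h (hO i).ne
    · obtain ⟨i, rfl⟩ := exists_outerVertex ha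
      obtain ⟨j, rfl⟩ := exists_outerVertex hb
      rcases lt_trichotomy i j with hij | rfl | hij
      · exact absurd h (hOO i j hij)
      · rfl
      · exact absurd h.symm (hOO j i hij)
  · by_cases ha : a = none
    · subst ha
      exact absurd h (hH j w').ne'
    · obtain ⟨i, rfl⟩ := exists_outerVertex ha
      exact absurd h (hOH i j w')
  · by_cases hb : b = none
    · subst hb
      exact absurd h (hH i w).ne
    · obtain ⟨j, rfl⟩ := exists_outerVertex hb
      exact absurd h.symm (hOH j i w)
  · by_contra hne
    rcases le_total i j with hij | hij
    · exact hHH i j w w' hij hne h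
    · exact hHH j i w' w hij (Ne.symm hne) h.symm

end CoronaEdge

/-! ### Degrees, and the numerical conditions of the theorem. -/

theorem coronaDegree_inr {p : ℕ} {W : Fin (3 * p) → Type*} [∀ i, Fintype (W i)]
    (H : ∀ i, SimpleGraph (W i)) [∀ i, DecidableRel (H i).Adj] (i : Fin (3 * p)) (w : W i) :
    coronaDegree H (.inr ⟨i, w⟩) = (H i).degree w + 2 := by
  classical
  rw [CoronaEdge.coronaDegree_eq, CoronaEdge.sum_incident_inr, ← Finset.card_eq_sum_ones,
    SimpleGraph.card_incidenceFinset_eq_degree]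

theorem coronaDegree_outerVertex_le {p : ℕ} {W : Fin (3 * p) → Type*} [∀ i, Fintype (W i)]
    (H : ∀ i, SimpleGraph (W i)) {i j : Fin (3 * p)} (hij : i ≤ j)
    (hcard : ∀ i j : Fin (3 * p), i ≤ j → Fintype.card (W i) ≤ Fintype.card (W j)) :
    coronaDegree H (.inl (outerVertex i)) ≤ coronaDegree H (.inl (outerVertex j)) := by
  have h := hcard i j hij
  have hij' := Fin.le_def.1 hij
  rw [CoronaEdge.coronaDegree_eq, CoronaEdge.coronaDegree_eq]
  by_cases hi : (i : ℕ) < 3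
  · rw [CoronaEdge.sum_incident_outerVertex_of_lt H _ hi]
    refine le_trans ?_ (CoronaEdge.le_weight_outerVertex H _ j)
    simpa using h
  · obtain ⟨i', hi'⟩ : ∃ i' : Fin (3 * p), (i : ℕ) = i' + 3 :=
      ⟨⟨i - 3, by omega⟩, by simp only; omega⟩
    obtain ⟨j', hj'⟩ : ∃ j' : Fin (3 * p), (j : ℕ) = j' + 3 :=
      ⟨⟨j - 3, by omega⟩, by simp only; omega⟩
    rw [CoronaEdge.sum_incident_outerVertex_of_eq H _ hi',
      CoronaEdge.sum_incident_outerVertex_of_eq H _ hj']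
    have := hcard i' j' (Fin.le_def.2 (by omega))
    simp only [Finset.sum_const, Finset.card_univ, smul_eq_mul, mul_one]
    omega

theorem coronaMinDegree_le {p : ℕ} {W : Fin (3 * p) → Type*} [∀ i, Fintype (W i)]
    (H : ∀ i, SimpleGraph (W i)) (i : Fin (3 * p)) (w : W i) :
    coronaMinDegree H i ≤ coronaDegree H (.inr ⟨i, w⟩) :=
  ciInf_le' _ w

theorem le_coronaMaxDegree {p : ℕ} {W : Fin (3 * p) → Type*} [∀ i, Fintype (W i)]
    (H : ∀ i, SimpleGraph (W i)) (i : Fin (3 * p)) (w : W i) :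
    coronaDegree H (.inr ⟨i, w⟩) ≤ coronaMaxDegree H i :=
  le_ciSup (f := fun w : W i => coronaDegree H (.inr ⟨i, w⟩)) (Set.finite_range _).bddAbove w

theorem Fin.rel_of_lt_of_rel_succ {n : ℕ} {r : Fin n → Fin n → Prop}
    (htrans : ∀ i j k, r i j → r j k → r i k)
    (hsucc : ∀ i j : Fin n, (i : ℕ) + 1 = j → r i j) {i j : Fin n} (hij : i < j) : r i j := by
  obtain ⟨j, hj⟩ := j
  rw [Fin.lt_def] at hij
  simp only at hij
  induction j with
  | zero => omega
  | succ j ih =>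
    have h := hsucc ⟨j, by omega⟩ ⟨j + 1, hj⟩ rfl
    rcases Nat.lt_succ_iff_lt_or_eq.1 hij with hlt | heq
    · exact htrans _ _ _ (ih (by omega) hlt) h
    · exact hsucc _ _ (by simp only; omega)

theorem mainTheorem3 (p : ℕ) (hp : 2 < p)
    (W : Fin (3 * p) → Type*) [∀ i, Fintype (W i)]
    (H : ∀ i, SimpleGraph (W i)) [∀ i, DecidableRel (H i).Adj]
    (hconn : ∀ i, (H i).Connected)
    (htwo : ∀ i, 2 ≤ Fintype.card (W i))
    (hmono : ∀ i j : Fin (3 * p), (i : ℕ) + 1 = j → Fintype.card (W i) ≤ Fintype.card (W j))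
    (h_i : ∀ i j : Fin (3 * p), (i : ℕ) + 1 = j → (H i).maxDegree ≤ (H j).minDegree)
    (h_ii_x : coronaDegree H (.inl (legVertex 0 (Fin.last p))) ≤
      coronaMinDegree H ⟨1, by omega⟩)
    (h_ii_y : coronaDegree H (.inl (legVertex 1 (Fin.last p))) ≤
      coronaMinDegree H ⟨2, by omega⟩)
    (h_ii_z : coronaDegree H (.inl (legVertex 2 (Fin.last p))) ≤
      coronaMinDegree H ⟨3, by omega⟩)
    (h_iii : ∀ i : Fin (3 * p),
      spiderEdge i = s(legVertex 2 ⟨1, by omega⟩, legVertex 2 ⟨2, by omega⟩) →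
      coronaMaxDegree H i ≤ Fintype.card (W ⟨3, by omega⟩) + 1)
    (h_iv : ∀ i : Fin (3 * p),
      spiderEdge i = s(legVertex 0 ⟨1, by omega⟩, legVertex 0 ⟨0, by omega⟩) →
      coronaDegree H (.inl (legVertex 2 ⟨2, by omega⟩)) ≤ coronaMinDegree H i) :
    IsAntimagic (spiderCorona H) := by
  classical
  have hne : ∀ i, Nonempty (W i) := fun i => (hconn i).nonempty
  have hcard : ∀ i j : Fin (3 * p), i ≤ j → Fintype.card (W i) ≤ Fintype.card (W j) := by
    intro i j hij
    rcases hij.lt_or_eq with h | rfl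
    · exact Fin.rel_of_lt_of_rel_succ (r := fun i j => Fintype.card (W i) ≤ Fintype.card (W j))
        (fun _ _ _ => le_trans) hmono h
    · exact le_rfl
  have hdeg : ∀ i j : Fin (3 * p), i < j → ∀ (w : W i) (w' : W j),
      (H i).degree w ≤ (H j).degree w' := by
    intro i j hij w w'
    refine ((H i).degree_le_maxDegree w).trans (le_trans ?_ ((H j).minDegree_le_degree w'))
    exact Fin.rel_of_lt_of_rel_succ (r := fun i j => (H i).maxDegree ≤ (H j).minDegree)
      -- Chaining needs `minDegree ≤ maxDegree` for the middle graph, obtained from any of its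
      -- vertices.
      (fun i j k h1 h2 => h1.trans (((H j).minDegree_le_degree (Classical.arbitrary _)).trans
        (((H j).degree_le_maxDegree _).trans h2))) h_i hij
  have hmin : ∀ (i j : Fin (3 * p)) (a : SpiderVertex p), i ≤ j →
      coronaDegree H (.inl a) ≤ coronaMinDegree H i → ∀ w : W j,
      coronaDegree H (.inl a) ≤ coronaDegree H (.inr ⟨j, w⟩) := by
    intro i j a hij h w
    rcases hij.lt_or_eq with hlt | rfl
    · have h1 := coronaMinDegree_le H i (Classical.arbitrary _)
      have h2 := hdeg i j hlt (Classical.arbitrary _) w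
      rw [coronaDegree_inr] at h1 ⊢
      omega
    · exact h.trans (coronaMinDegree_le H i w)
  have houter : ∀ (i : Fin (3 * p)) (l : Fin 3) (k : ℕ) (hk : k < p + 1), (i : ℕ) % 3 = l →
      p - (i : ℕ) / 3 = k → outerVertex i = legVertex l ⟨k, hk⟩ := by
    intro i l k hk h1 h2
    have hi := i.2
    change legVertex (spiderEdgeLeg i) (spiderEdgePos i).succ = _
    congr 1
    · exact Fin.ext h1
    · ext
      simp only [spiderEdgePos, Fin.succ_mk]
      omega
  have hinner : ∀ (i : Fin (3 * p)) (l : Fin 3) (k : ℕ) (hk : k < p + 1), (i : ℕ) % 3 = l →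
      p - 1 - (i : ℕ) / 3 = k → innerVertex i = legVertex l ⟨k, hk⟩ := by
    intro i l k hk h1 h2
    rw [innerVertex]
    congr 1
    · exact Fin.ext h1
    · ext
      simpa only [spiderEdgePos, Fin.castSucc_mk] using h2
  obtain ⟨g, hbij, hg, htie⟩ := (CoronaEdge.edges H).exists_labeling_of_rank
    (CoronaEdge.incident H) (fun v x hx => (CoronaEdge.mem_incident.1 hx).1)
    CoronaEdge.rank CoronaEdge.anchor
  refine CoronaEdge.isAntimagic H g hbij
    (CoronaEdge.weight_injective hp hg htie hcard hdeg ?_ ?_ ?_)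
  · have hlt : 3 * p - 4 < 3 * p := by omega
    intro i j hi hj w
    -- The edge `z₂z₁` is the last one not meeting the centre, so its graph has the largest degrees
    -- among all `i` concerned. Since `d'` exceeds the degree in `H i` by `2`, the bound with `+ 1`
    -- becomes `(H i).degree w + 1 ≤ Fintype.card (W j)`.
    have h1 := h_iii ⟨3 * p - 4, hlt⟩ (by
      rw [spiderEdge_eq, Sym2.eq_swap, houter _ 2 2 (by omega) (by simp only [Fin.val_two]; omega)
        (by simp only; omega), hinner _ 2 1 (by omega) (by simp only [Fin.val_two]; omega)
        (by simp only; omega)])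
    have h2 := hcard ⟨3, by omega⟩ j (Fin.le_def.2 hj)
    have h3 : (H i).degree w + 2 ≤ coronaMaxDegree H ⟨3 * p - 4, hlt⟩ := by
      rcases (Fin.le_def.2 (by simp only; omega) :
        i ≤ (⟨3 * p - 4, hlt⟩ : Fin (3 * p))).lt_or_eq with h | rfl
      · have h4 := hdeg _ _ h w (Classical.arbitrary _)
        have h5 := le_coronaMaxDegree H ⟨3 * p - 4, hlt⟩ (Classical.arbitrary _)
        rw [coronaDegree_inr] at h5
        omega
      · have h5 := le_coronaMaxDegree H ⟨3 * p - 4, hlt⟩ w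
        rwa [coronaDegree_inr] at h5
    omega
  · intro i j hi hij w
    have hij' := Fin.lt_def.1 hij
    obtain ⟨i, hi'⟩ := i
    simp only at hi hij'
    interval_cases i
    · rw [houter _ 0 p (by omega) rfl (by simp)]
      exact hmin _ j _ (Fin.le_def.2 (by simp only; omega)) h_ii_x w
    · rw [houter _ 1 p (by omega) rfl (by simp)]
      exact hmin _ j _ (Fin.le_def.2 (by simp only; omega)) h_ii_y w
    · rw [houter _ 2 p (by omega) rfl (by simp)]
      exact hmin _ j _ (Fin.le_def.2 (by simp only; omega)) h_ii_z w
  · intro i j hi hj w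
    have h1 := h_iv ⟨3 * p - 3, by omega⟩ (by
      rw [spiderEdge_eq, houter _ 0 1 (by omega) (by simp only [Fin.val_zero]; omega)
        (by simp only; omega), hinner _ 0 0 (by omega) (by simp only [Fin.val_zero]; omega)
        (by simp only; omega)])
    -- Degrees of outer ends grow along the enumeration, so `z₂`, the outer end of the last edge not
    -- meeting the centre, is the worst case.
    refine (coronaDegree_outerVertex_le H (j := ⟨3 * p - 4, by omega⟩)
      (Fin.le_def.2 (by simp only; omega)) hcard).trans ?_
    rw [houter ⟨3 * p - 4, by omega⟩ 2 2 (by omega) (by simp only [Fin.val_two]; omega)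
      (by simp only; omega)]
    exact hmin _ j _ (Fin.le_def.2 (by simp only; omega)) h1 w
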